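/- Let $n\ge 2$ be an even integer and let $p>0$ be real. Let $|\mathbb S^n|$ denote the volume of the standard unit $n$-sphere. Let $u:\mathbb R^n\to\mathbb R$ be a continuous function that is radially symmetric about the origin, satisfies $(1+|x|^{np})e^{nu}\in L^1(\mathbb R^n)$, and solves, for some constant $C\in\mathbb R$, the integral equation $$u(x)=\frac{2}{(n-1)!\,|\mathbb S^n|}\int_{\mathbb R^n}\log\frac{|y|}{|x-y|}\,\bigl(1+|y|^{np}\bigr)e^{nu(y)}\,dy+C\qquad\text{for all }x\in\mathbb R^n$$ (that is, $u$ is a radial normal solution with $Q(x)=1+|x|^{np}$). Set $$\beta:=\frac{2}{(n-1)!\,|\mathbb S^n|}\int_{\mathbb R^n}(1+|x|^{np})e^{nu(x)}\,dx .$$ Then $$\max\{2,2p\}<\beta<2+2p .$$ -/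

import Mathlib

open MeasureTheory
open scoped Nat

/-- The volume `|𝕊ⁿ|` of the standard unit `n`-sphere, the unit sphere of `ℝⁿ⁺¹` with its
surface measure. -/
noncomputable def sphereVolume (n : ℕ) : ℝ :=
  ((volume : Measure (EuclideanSpace ℝ (Fin (n + 1)))).toSphere).real Set.univ

/-- The normalizing constant `2 / ((n - 1)! |𝕊ⁿ|)` (used for `n ≥ 2`). -/
noncomputable def normConst (n : ℕ) : ℝ :=
  2 / (((n - 1)! : ℕ) * sphereVolume n)

/-- `u` is a normal solution of `(-Δ)^(n/2) u = Q e^(n u)` on `ℝⁿ`: the function `Q e^(n u)` is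
integrable and, for some constant `C` and all `x`,
`u(x) = 2 / ((n - 1)! |𝕊ⁿ|) * ∫ log (|y| / |x - y|) Q(y) e^(n u(y)) dy + C`. -/
structure IsNormalSolution (n : ℕ) (Q u : EuclideanSpace ℝ (Fin n) → ℝ) : Prop where
  continuous : Continuous u
  integrable : Integrable (fun y => Q y * Real.exp (n * u y))
  /-- The integral in the equation exists. When `Q` is continuous this already follows from the
  other fields. -/
  integrable_log : ∀ x, Integrable
    (fun y => Real.log (‖y‖ / ‖x - y‖) * (Q y * Real.exp (n * u y)))
  equation : ∃ C : ℝ, ∀ x, u x =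
    normConst n * (∫ y, Real.log (‖y‖ / ‖x - y‖) * (Q y * Real.exp (n * u y))) + C

/-- The normalized integrated Q-curvature `2 / ((n - 1)! |𝕊ⁿ|) * ∫ Q e^(n u) dx`. -/
noncomputable def normalizedTotalQ (n : ℕ) (Q u : EuclideanSpace ℝ (Fin n) → ℝ) : ℝ :=
  normConst n * ∫ x, Q x * Real.exp (n * u x)

/-- Radial symmetry about the origin. -/
def IsRadial {n : ℕ} (u : EuclideanSpace ℝ (Fin n) → ℝ) : Prop :=
  ∀ x y, ‖x‖ = ‖y‖ → u x = u y

/-- The function `Q(x) = 1 + |x|^(n p)` on `ℝⁿ`. -/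
noncomputable def powerQ (n : ℕ) (p : ℝ) (x : EuclideanSpace ℝ (Fin n)) : ℝ :=
  1 + ‖x‖ ^ ((n : ℝ) * p)

/-! Write `c` for the normalizing constant, `f₀ = e^(nu)`, `f₁ = |x|^(np) e^(nu)`, and `b₀`, `b₁`
for `c` times their integrals, so that `β = b₀ + b₁`. Each density satisfies its own Pohozaev
identity, obtained by differentiating the dilation-invariant integral of `e^(ns) f(e^s x)`; this
needs the radial derivative of `u`.

The radial derivative of `log |x - y|` is unbounded near `y = x` and has no sign. Since `n` is even,
`ℝⁿ` carries a complex structure `J`, and since the density is radial, the logarithm may be averaged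
over the circle of rotations `cos θ + (sin θ) J`. By Jensen's formula the average is the explicit
`orbitLog`, whose scaling derivative `orbitSlope` takes values in `[0, 1]` and satisfies `k(x, y) +
k(y, x) = 1` (`orbitSlope_add_swap`). Hence the self-interaction of a density is half the square of
its mass, and the two cross terms add up to `b₀ b₁`.

With `α > 0` the cross term of `f₀` against `f₁`, the identities from `scaling_identity` become `b₀
= b₀²/2 + α` and `(1 + p) b₁ = b₁²/2 + b₀ b₁ - α`. The bounds follow by algebra
(`total_bounds_of_balance`). -/

/-! ### The circle-averaged logarithm and its slope. -/

/-- The discriminant root `√((R + S)² - 4 W)`. -/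
noncomputable def orbitDisc (R S W : ℝ) : ℝ := Real.sqrt ((R + S) ^ 2 - 4 * W)

/-- The mean of `log √(R + S - 2 Re (ζ̄ w))` over the unit circle, when `‖w‖² = W ≤ R S`. -/
noncomputable def orbitLog (R S W : ℝ) : ℝ := 1 / 2 * Real.log ((R + S + orbitDisc R S W) / 2)

/-- The logarithmic scaling derivative of `orbitLog` in its first argument. -/
noncomputable def orbitSlope (R S W : ℝ) : ℝ := (1 + (R - S) / orbitDisc R S W) / 2

theorem abs_sub_le_orbitDisc {R S W : ℝ} (h : W ≤ R * S) : |R - S| ≤ orbitDisc R S W := by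
  refine Real.le_sqrt_of_sq_le ?_
  rw [sq_abs]; nlinarith

theorem orbitDisc_sq {R S W : ℝ} (h : W ≤ R * S) :
    orbitDisc R S W ^ 2 = (R + S) ^ 2 - 4 * W :=
  Real.sq_sqrt (by nlinarith [sq_nonneg (R - S)])

theorem orbitDisc_nonneg (R S W : ℝ) : 0 ≤ orbitDisc R S W := Real.sqrt_nonneg _

theorem orbitDisc_comm (R S W : ℝ) : orbitDisc R S W = orbitDisc S R W := by
  rw [orbitDisc, orbitDisc, add_comm R S]

theorem orbitSlope_nonneg {R S W : ℝ} (h : W ≤ R * S) : 0 ≤ orbitSlope R S W := by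
  have h1 := abs_sub_le_orbitDisc h
  have : |(R - S) / orbitDisc R S W| ≤ 1 := by
    rw [abs_div, abs_of_nonneg (orbitDisc_nonneg R S W)]
    exact div_le_one_of_le₀ h1 (orbitDisc_nonneg R S W)
  have := (abs_le.1 this).1
  unfold orbitSlope; linarith

/-- The two quotients have opposite numerators and a common denominator. If the discriminant
vanishes both are `0` by convention, so there is no exceptional case. -/
theorem orbitSlope_add_swap (R S W : ℝ) : orbitSlope R S W + orbitSlope S R W = 1 := by
  unfold orbitSlope
  rw [orbitDisc_comm S R W]; ring

theorem orbitSlope_le_one {R S W : ℝ} (h : W ≤ R * S) : orbitSlope R S W ≤ 1 := by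
  have := orbitSlope_add_swap R S W
  have := orbitSlope_nonneg (R := S) (S := R) (W := W) (by linarith [mul_comm R S])
  linarith

theorem orbitSlope_pos_of_lt {R S W : ℝ} (hRS : S < R) : 0 < orbitSlope R S W := by
  have : 0 ≤ (R - S) / orbitDisc R S W :=
    div_nonneg (by linarith) (orbitDisc_nonneg _ _ _)
  unfold orbitSlope; linarith

/-- Adding `k R + S` to both sides shows that `R + S + D` grows by at most the factor `k` under
scaling; `le_orbitDisc_scale` shows likewise that it does not decrease. -/
theorem orbitDisc_scale_le {R S W k : ℝ} (hS : 0 ≤ S) (h : W ≤ R * S) (hk : 1 ≤ k) :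
    orbitDisc (k * R) S (k * W) ≤ k * orbitDisc R S W + (k - 1) * S := by
  have h0 := orbitDisc_nonneg R S W
  have h1 := neg_abs_le (R - S)
  have h2 := abs_sub_le_orbitDisc h
  have h3 := orbitDisc_sq h
  set D := orbitDisc R S W
  refine Real.sqrt_le_iff.2 ⟨by nlinarith, ?_⟩
  have e : (k * D + (k - 1) * S) ^ 2 - ((k * R + S) ^ 2 - 4 * (k * W))
      = 2 * (k * (k - 1)) * (R * S + S ^ 2 + S * D - 2 * W) := by
    have : (k * D + (k - 1) * S) ^ 2 = k ^ 2 * D ^ 2 + 2 * k * (k - 1) * S * D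
      + (k - 1) ^ 2 * S ^ 2 := by ring
    rw [this, h3]; ring
  have : 0 ≤ 2 * (k * (k - 1)) * (R * S + S ^ 2 + S * D - 2 * W) := by
    refine mul_nonneg (by nlinarith) ?_
    nlinarith [mul_nonneg hS (show 0 ≤ D - (R - S) by linarith [le_abs_self (R - S)])]
  linarith

theorem le_orbitDisc_scale {R S W k : ℝ} (hR : 0 ≤ R) (h : W ≤ R * S) (hk : 1 ≤ k) :
    orbitDisc R S W ≤ orbitDisc (k * R) S (k * W) + (k - 1) * R := by
  have h' : k * W ≤ k * R * S := by nlinarith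
  have h0 := orbitDisc_nonneg (k * R) S (k * W)
  have h2 := abs_sub_le_orbitDisc h'
  have h3 := orbitDisc_sq h'
  have h1 := neg_abs_le (k * R - S)
  set D := orbitDisc (k * R) S (k * W)
  refine Real.sqrt_le_iff.2 ⟨by nlinarith, ?_⟩
  have e : (D + (k - 1) * R) ^ 2 - ((R + S) ^ 2 - 4 * W)
      = (k - 1) * (2 * k * R ^ 2 + 2 * R * S - 4 * W + 2 * R * D) := by
    have : (D + (k - 1) * R) ^ 2 = D ^ 2 + 2 * (k - 1) * R * D + (k - 1) ^ 2 * R ^ 2 := by ring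
    rw [this, h3]; ring
  have : 0 ≤ (k - 1) * (2 * k * R ^ 2 + 2 * R * S - 4 * W + 2 * R * D) := by
    refine mul_nonneg (by linarith) ?_
    nlinarith [mul_nonneg hR (show 0 ≤ D - (S - k * R) by linarith)]
  linarith

/-- Scaling by `k = e^(2r)` multiplies the argument of the logarithm by a factor between `1` and
`k`. This route avoids the derivative, which may fail to exist where the discriminant vanishes. -/
theorem abs_orbitLog_exp_sub_le {R S W : ℝ} (hR : 0 ≤ R) (hS : 0 < S) (h : W ≤ R * S) (s t : ℝ) :
    |orbitLog (Real.exp (2 * s) * R) S (Real.exp (2 * s) * W)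
      - orbitLog (Real.exp (2 * t) * R) S (Real.exp (2 * t) * W)| ≤ |s - t| := by
  have key : ∀ {R W : ℝ}, 0 ≤ R → W ≤ R * S → ∀ {r : ℝ}, 0 ≤ r →
      |orbitLog (Real.exp (2 * r) * R) S (Real.exp (2 * r) * W) - orbitLog R S W| ≤ r := by
    intro R W hR h r hr
    have hk : 1 ≤ Real.exp (2 * r) := Real.one_le_exp (by linarith)
    have h1 := orbitDisc_scale_le hS.le h hk
    have h2 := le_orbitDisc_scale hR h hk
    have h0 := orbitDisc_nonneg R S W
    have hlog : 1 / 2 * Real.log (Real.exp (2 * r)) = r := by rw [Real.log_exp]; ring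
    set k := Real.exp (2 * r)
    have hk0 : 0 < k := by linarith
    unfold orbitLog
    have hp : 0 < (R + S + orbitDisc R S W) / 2 := by linarith
    have lo : Real.log ((R + S + orbitDisc R S W) / 2) ≤
        Real.log ((k * R + S + orbitDisc (k * R) S (k * W)) / 2) :=
      Real.log_le_log hp (by linarith)
    have up : Real.log ((k * R + S + orbitDisc (k * R) S (k * W)) / 2) ≤
        Real.log k + Real.log ((R + S + orbitDisc R S W) / 2) := by
      rw [← Real.log_mul hk0.ne' hp.ne']
      exact Real.log_le_log (by linarith) (by linarith)
    rw [abs_le]; constructor <;> linarith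
  have main : ∀ s t : ℝ, t ≤ s →
      |orbitLog (Real.exp (2 * s) * R) S (Real.exp (2 * s) * W)
      - orbitLog (Real.exp (2 * t) * R) S (Real.exp (2 * t) * W)| ≤ s - t := by
    intro s t hst
    have hpos := Real.exp_pos (2 * t)
    have := key (R := Real.exp (2 * t) * R) (W := Real.exp (2 * t) * W) (by positivity)
      (by rw [mul_assoc]; exact mul_le_mul_of_nonneg_left h hpos.le) (sub_nonneg.2 hst)
    rwa [← mul_assoc, ← mul_assoc, ← Real.exp_add, ← mul_add, sub_add_cancel] at this
  rcases le_total t s with hst | hst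
  · rw [abs_of_nonneg (sub_nonneg.2 hst)]; exact main s t hst
  · rw [abs_sub_comm, abs_sub_comm s t, abs_of_nonneg (sub_nonneg.2 hst)]; exact main t s hst

theorem hasDerivAt_orbitLog_exp {R S W t : ℝ} (hR : 0 ≤ R) (hS : 0 < S) (h : W ≤ R * S)
    (hD : Real.exp (2 * t) * R ≠ S) :
    HasDerivAt (fun s => orbitLog (Real.exp (2 * s) * R) S (Real.exp (2 * s) * W))
      (orbitSlope (Real.exp (2 * t) * R) S (Real.exp (2 * t) * W)) t := by
  have hpos := Real.exp_pos (2 * t)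
  have h' : Real.exp (2 * t) * W ≤ Real.exp (2 * t) * R * S := by
    rw [mul_assoc]; exact mul_le_mul_of_nonneg_left h hpos.le
  have hk : HasDerivAt (fun s => Real.exp (2 * s)) (2 * Real.exp (2 * t)) t := by
    have := ((hasDerivAt_id t).const_mul 2).exp
    simpa [mul_comm] using! this
  have hD0 : 0 < orbitDisc (Real.exp (2 * t) * R) S (Real.exp (2 * t) * W) :=
    (abs_pos.2 (sub_ne_zero.2 hD)).trans_le (abs_sub_le_orbitDisc h')
  have hsq := orbitDisc_sq h'
  have hq0 : (Real.exp (2 * t) * R + S) ^ 2 - 4 * (Real.exp (2 * t) * W) ≠ 0 := by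
    rw [← hsq]; positivity
  have hq := ((((hk.mul_const R).add_const S).pow 2).sub ((hk.mul_const W).const_mul 4)).sqrt hq0
  have hp : (Real.exp (2 * t) * R + S + orbitDisc (Real.exp (2 * t) * R) S
      (Real.exp (2 * t) * W)) / 2 ≠ 0 := by positivity
  have hl := (((((hk.mul_const R).add_const S).add hq).div_const 2).log hp).const_mul (1 / 2)
  refine hl.congr_deriv ?_
  change 1 / 2 * (_ / ((Real.exp (2 * t) * R + S + orbitDisc (Real.exp (2 * t) * R) S
      (Real.exp (2 * t) * W)) / 2)) = _
  have hD1 : √(((fun s => Real.exp (2 * s) * R + S) ^ 2 - fun s => 4 * (Real.exp (2 * s) * W)) t)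
    = orbitDisc (Real.exp (2 * t) * R) S (Real.exp (2 * t) * W) := rfl
  unfold orbitSlope
  simp only [hD1] at *
  generalize Real.exp (2 * t) = k at *
  have hs : 0 < k * R + S + orbitDisc (k * R) S (k * W) := by positivity
  set D := orbitDisc (k * R) S (k * W)
  field_simp
  linear_combination (-1 : ℝ) * hsq

/-- Let `α²` be the larger root of `z² - (R + S) z + |w|² = 0`. Then the quantity under the root is
`|α e^(iθ) - w/α|²` with `|w/α| ≤ α`, and Jensen's formula gives the mean `log α`. -/
theorem circle_mean_log {R S : ℝ} {w : ℂ} (hR : 0 ≤ R) (hS : 0 < S) (h : ‖w‖ ^ 2 ≤ R * S) :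
    (2 * Real.pi)⁻¹ * ∫ θ in (0 : ℝ)..2 * Real.pi,
      Real.log (√(R + S - 2 * (Real.cos θ * w.re + Real.sin θ * w.im))) =
    orbitLog R S (‖w‖ ^ 2) := by
  have h0 := orbitDisc_nonneg R S (‖w‖ ^ 2)
  have hsq := orbitDisc_sq h
  set D := orbitDisc R S (‖w‖ ^ 2) with hDdef
  have hP : 0 < (R + S + D) / 2 := by positivity
  set α := √((R + S + D) / 2) with hα
  have hα0 : 0 < α := Real.sqrt_pos.2 hP
  have hα2 : α ^ 2 = (R + S + D) / 2 := Real.sq_sqrt hP.le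
  have hw : ‖w‖ ^ 2 = α ^ 2 * (R + S - α ^ 2) := by rw [hα2]; nlinarith
  have hwα : ‖w / (α : ℂ)‖ ≤ α := by
    rw [norm_div, Complex.norm_real, Real.norm_of_nonneg hα0.le, div_le_iff₀ hα0]
    refine abs_le_of_sq_le_sq' ?_ (by positivity) |>.2
    rw [hw]
    nlinarith [sq_nonneg α]
  have hmem : w / (α : ℂ) ∈ Metric.closedBall (0 : ℂ) |α| := by
    rw [mem_closedBall_zero_iff, abs_of_pos hα0]; exact hwα
  have := circleAverage_log_norm_sub_const_of_mem_closedBall hmem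
  rw [Real.circleAverage_def, smul_eq_mul] at this
  rw [orbitLog, ← hDdef, ← hα2, Real.log_pow]
  push_cast
  rw [show (1 : ℝ) / 2 * (2 * Real.log α) = Real.log α by ring, ← this]
  congr 1
  refine intervalIntegral.integral_congr fun θ _ => ?_
  have hn : R + S - 2 * (Real.cos θ * w.re + Real.sin θ * w.im)
      = ‖circleMap 0 α θ - w / (α : ℂ)‖ ^ 2 := by
    have hww : w.re ^ 2 + w.im ^ 2 = α ^ 2 * (R + S - α ^ 2) := by
      rw [← hw, Complex.sq_norm, Complex.normSq_apply]; ring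
    rw [Complex.sq_norm, Complex.normSq_apply]
    have e : circleMap 0 α θ = ⟨α * Real.cos θ, α * Real.sin θ⟩ := by
      apply Complex.ext <;> simp [circleMap, Complex.exp_ofReal_mul_I_re,
        Complex.exp_ofReal_mul_I_im]
    rw [e]
    simp only [Complex.sub_re, Complex.sub_im, Complex.div_ofReal_re, Complex.div_ofReal_im]
    field_simp
    linear_combination (-1 : ℝ) * hww - α ^ 4 * Real.sin_sq_add_cos_sq θ
  change _ = Real.log ‖circleMap 0 α θ - w / (α : ℂ)‖
  rw [hn, Real.sqrt_sq (norm_nonneg _)]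

/-! ### Complex structures and rotation averages of logarithmic potentials. -/

section Rotation

variable {E : Type*} [NormedAddCommGroup E] [InnerProductSpace ℝ E]

/-- The squared modulus of the Hermitian product of `x` and `y` for the complex structure `J`. -/
noncomputable def hermSq (J : E →ₗᵢ[ℝ] E) (x y : E) : ℝ := inner ℝ x y ^ 2 + inner ℝ x (J y) ^ 2

theorem inner_skew {J : E →ₗᵢ[ℝ] E} (hJ : ∀ x, inner ℝ x (J x) = 0) (x y : E) :
    inner ℝ x (J y) = - inner ℝ y (J x) := by
  have := hJ (x + y)
  rw [map_add, inner_add_left, inner_add_right, inner_add_right, hJ, hJ] at this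
  linarith

theorem hermSq_comm {J : E →ₗᵢ[ℝ] E} (hJ : ∀ x, inner ℝ x (J x) = 0) (x y : E) :
    hermSq J x y = hermSq J y x := by
  rw [hermSq, hermSq, inner_skew hJ x y, real_inner_comm, neg_sq]

/-- Bessel's inequality: `y` and `J y` are orthogonal and of equal norm. The proof applies
Cauchy–Schwarz to `x` and the combination `a y + b J y`. -/
theorem hermSq_le {J : E →ₗᵢ[ℝ] E} (hJ : ∀ x, inner ℝ x (J x) = 0) (x y : E) :
    hermSq J x y ≤ ‖x‖ ^ 2 * ‖y‖ ^ 2 := by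
  set a := inner ℝ x y with ha
  set b := inner ℝ x (J y) with hb
  have h1 : inner ℝ x (a • y + b • J y) = a ^ 2 + b ^ 2 := by
    rw [inner_add_right, inner_smul_right, inner_smul_right, ← ha, ← hb]; ring
  have h2 : ‖a • y + b • J y‖ ^ 2 = (a ^ 2 + b ^ 2) * ‖y‖ ^ 2 := by
    rw [norm_add_sq_real, inner_smul_left, inner_smul_right, hJ, norm_smul, norm_smul,
      J.norm_map, mul_pow, mul_pow, Real.norm_eq_abs, Real.norm_eq_abs, sq_abs, sq_abs]
    ring
  have h3 := abs_real_inner_le_norm x (a • y + b • J y)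
  rw [h1] at h3
  have h4 : (a ^ 2 + b ^ 2) ^ 2 ≤ ‖x‖ ^ 2 * ((a ^ 2 + b ^ 2) * ‖y‖ ^ 2) := by
    rw [← h2, ← mul_pow, ← sq_abs (a ^ 2 + b ^ 2)]
    exact pow_le_pow_left₀ (abs_nonneg _) h3 2
  change a ^ 2 + b ^ 2 ≤ _
  rcases (show 0 ≤ a ^ 2 + b ^ 2 by positivity).eq_or_lt with h0 | h0
  · rw [← h0]; positivity
  · refine le_of_mul_le_mul_left ?_ h0
    nlinarith

theorem hermSq_smul (J : E →ₗᵢ[ℝ] E) (r : ℝ) (x y : E) :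
    hermSq J (r • x) y = r ^ 2 * hermSq J x y := by
  simp only [hermSq, inner_smul_left, conj_trivial]; ring

theorem norm_cos_sin {J : E →ₗᵢ[ℝ] E} (hJ : ∀ x, inner ℝ x (J x) = 0) (θ : ℝ) (y : E) :
    ‖Real.cos θ • y + Real.sin θ • J y‖ = ‖y‖ := by
  rw [← sq_eq_sq₀ (norm_nonneg _) (norm_nonneg _), norm_add_sq_real, inner_smul_left,
    inner_smul_right, hJ, norm_smul, norm_smul, J.norm_map, mul_pow, mul_pow, Real.norm_eq_abs,
    Real.norm_eq_abs, sq_abs, sq_abs]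
  linear_combination ‖y‖ ^ 2 * Real.sin_sq_add_cos_sq θ

/-- The rotation `cos θ + (sin θ) J`. -/
noncomputable def skewRotation [FiniteDimensional ℝ E] (J : E →ₗᵢ[ℝ] E)
    (hJ : ∀ x, inner ℝ x (J x) = 0) (θ : ℝ) : E ≃ₗᵢ[ℝ] E :=
  LinearIsometry.toLinearIsometryEquiv
    { toLinearMap := Real.cos θ • LinearMap.id + Real.sin θ • J.toLinearMap
      norm_map' := norm_cos_sin hJ θ } rfl

theorem skewRotation_apply [FiniteDimensional ℝ E] {J : E →ₗᵢ[ℝ] E}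
    (hJ : ∀ x, inner ℝ x (J x) = 0) (θ : ℝ) (y : E) :
    skewRotation J hJ θ y = Real.cos θ • y + Real.sin θ • J y := rfl

theorem norm_sub_skewRotation [FiniteDimensional ℝ E] {J : E →ₗᵢ[ℝ] E}
    (hJ : ∀ x, inner ℝ x (J x) = 0) (θ : ℝ) (x y : E) :
    ‖x - skewRotation J hJ θ y‖ = √(‖x‖ ^ 2 + ‖y‖ ^ 2 -
      2 * (Real.cos θ * inner ℝ x y + Real.sin θ * inner ℝ x (J y))) := by
  rw [← Real.sqrt_sq (norm_nonneg (x - skewRotation J hJ θ y)), norm_sub_sq_real,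
    LinearIsometryEquiv.norm_map, skewRotation_apply, inner_add_right, inner_smul_right,
    inner_smul_right]
  congr 1; ring

theorem mean_log_norm_sub_skewRotation [FiniteDimensional ℝ E] {J : E →ₗᵢ[ℝ] E}
    (hJ : ∀ x, inner ℝ x (J x) = 0) (x : E) {y : E} (hy : y ≠ 0) :
    (2 * Real.pi)⁻¹ * ∫ θ in (0 : ℝ)..2 * Real.pi, Real.log ‖x - skewRotation J hJ θ y‖ =
      orbitLog (‖x‖ ^ 2) (‖y‖ ^ 2) (hermSq J x y) := by
  have hw : ‖(⟨inner ℝ x y, inner ℝ x (J y)⟩ : ℂ)‖ ^ 2 = hermSq J x y := by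
    rw [Complex.sq_norm, Complex.normSq_apply, hermSq]; ring
  have := circle_mean_log (R := ‖x‖ ^ 2) (S := ‖y‖ ^ 2)
    (w := ⟨inner ℝ x y, inner ℝ x (J y)⟩) (by positivity) (by positivity)
    (by rw [hw]; exact hermSq_le hJ x y)
  rw [hw] at this
  simp_rw [norm_sub_skewRotation]
  exact this

variable [FiniteDimensional ℝ E] [MeasurableSpace E] [BorelSpace E]

theorem ae_ne_zero_and_norm_ne [Nontrivial E] (r : ℝ) : ∀ᵐ y : E, y ≠ 0 ∧ ‖y‖ ≠ r := by
  refine Filter.Eventually.and (measure_eq_zero_iff_ae_notMem.1 (measure_singleton (0 : E))) ?_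
  filter_upwards [measure_eq_zero_iff_ae_notMem.1 (Measure.addHaar_sphere volume (0 : E) r)]
    with y hy
  simpa using hy

theorem measurable_orbitSlope_kernel (J : E →ₗᵢ[ℝ] E) :
    Measurable fun z : E × E => orbitSlope (‖z.1‖ ^ 2) (‖z.2‖ ^ 2) (hermSq J z.1 z.2) := by
  have h : Continuous fun z : E × E => hermSq J z.1 z.2 := by
    have := J.continuous
    unfold hermSq; fun_prop
  unfold orbitSlope orbitDisc
  have h1 : Measurable fun z : E × E => √((‖z.1‖ ^ 2 + ‖z.2‖ ^ 2) ^ 2 - 4 * hermSq J z.1 z.2) :=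
    Continuous.measurable (by fun_prop)
  have h2 : Measurable fun z : E × E => ‖z.1‖ ^ 2 - ‖z.2‖ ^ 2 := Continuous.measurable (by fun_prop)
  exact ((h2.div h1).const_add 1).div_const 2

/-- A logarithmic potential of a radial density is the potential of its rotation-averaged
kernel. -/
theorem log_potential_eq_orbitLog [Nontrivial E] {J : E →ₗᵢ[ℝ] E}
    (hJ : ∀ x, inner ℝ x (J x) = 0) {K : E → ℝ} (hK : Integrable K)
    (hrad : ∀ x y, ‖x‖ = ‖y‖ → K x = K y) {x : E}
    (hlog : Integrable fun y => Real.log (‖y‖ / ‖x - y‖) * K y) :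
    Integrable (fun y =>
      (Real.log ‖y‖ - orbitLog (‖x‖ ^ 2) (‖y‖ ^ 2) (hermSq J x y)) * K y) ∧
    ∫ y, Real.log (‖y‖ / ‖x - y‖) * K y =
      ∫ y, (Real.log ‖y‖ - orbitLog (‖x‖ ^ 2) (‖y‖ ^ 2) (hermSq J x y)) * K y := by
  set ν : Measure ℝ := volume.restrict (Set.Ioc 0 (2 * Real.pi)) with hν
  set g : E → ℝ := fun y => Real.log (‖y‖ / ‖x - y‖) * K y with hg
  set f : ℝ → E → ℝ := fun θ y => Real.log (‖y‖ / ‖x - skewRotation J hJ θ y‖) * K y with hf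
  have hfg : ∀ θ, f θ = g ∘ skewRotation J hJ θ := by
    intro θ; funext y
    simp only [hf, hg, Function.comp, LinearIsometryEquiv.norm_map]
    rw [hrad (skewRotation J hJ θ y) y (LinearIsometryEquiv.norm_map _ _)]
  have hmp := fun θ => (skewRotation J hJ θ).measurePreserving
  have hemb := fun θ => (skewRotation J hJ θ).toHomeomorph.measurableEmbedding
  have hint : ∀ θ, Integrable (f θ) := fun θ => by
    rw [hfg]; exact ((hmp θ).integrable_comp_emb (hemb θ)).2 hlog
  have hval : ∀ θ, ∫ y, f θ y = ∫ y, g y := fun θ => by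
    rw [hfg]; exact (hmp θ).integral_comp (hemb θ) g
  have hnorm : ∀ θ, ∫ y, ‖f θ y‖ = ∫ y, ‖g y‖ := fun θ => by
    rw [hfg]; exact (hmp θ).integral_comp (hemb θ) (fun y => ‖g y‖)
  have hmeas : AEStronglyMeasurable (Function.uncurry f) (ν.prod volume) := by
    have h1 : Continuous fun z : ℝ × E => ‖x - skewRotation J hJ z.1 z.2‖ := by
      have := J.continuous
      simp only [skewRotation_apply]; fun_prop
    have h2 : Measurable fun z : ℝ × E =>
        Real.log (‖z.2‖ / ‖x - skewRotation J hJ z.1 z.2‖) :=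
      Real.measurable_log.comp ((Continuous.measurable (by fun_prop)).div h1.measurable)
    exact h2.aestronglyMeasurable.mul hK.aestronglyMeasurable.comp_snd
  -- Every slice in `θ` has the same `L¹` norm, because rotations preserve volume and `K` is radial;
  -- this gives joint integrability for Fubini.
  have hprod : Integrable (Function.uncurry f) (ν.prod volume) := by
    refine (integrable_prod_iff hmeas).2 ⟨Filter.Eventually.of_forall hint, ?_⟩
    simp only [Function.uncurry, hnorm]
    exact integrable_const _
  have hinner : ∀ᵐ y : E, (2 * Real.pi)⁻¹ * ∫ θ, f θ y ∂ν =
      (Real.log ‖y‖ - orbitLog (‖x‖ ^ 2) (‖y‖ ^ 2) (hermSq J x y)) * K y := by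
    -- Off the sphere `‖y‖ = ‖x‖` the rotated `y` never meets `x`, so the logarithm is continuous in
    -- `θ`.
    filter_upwards [ae_ne_zero_and_norm_ne ‖x‖] with y hy
    have hne : ∀ θ, ‖x - skewRotation J hJ θ y‖ ≠ 0 := fun θ h0 => hy.2 (by
      rw [sub_eq_zero.1 (norm_eq_zero.1 h0), LinearIsometryEquiv.norm_map])
    have hc : Continuous fun θ => Real.log ‖x - skewRotation J hJ θ y‖ := by
      refine Continuous.log ?_ hne
      simp only [skewRotation_apply]; fun_prop
    have he : ∀ θ, f θ y = (Real.log ‖y‖ - Real.log ‖x - skewRotation J hJ θ y‖) * K y :=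
      fun θ => by rw [hf]; simp only; rw [Real.log_div (norm_ne_zero_iff.2 hy.1) (hne θ)]
    simp_rw [he]
    rw [integral_mul_const, hν, ← intervalIntegral.integral_of_le (by positivity),
      intervalIntegral.integral_sub (by simp) (hc.intervalIntegrable _ _),
      ← mean_log_norm_sub_skewRotation hJ x hy.1, intervalIntegral.integral_const, smul_eq_mul]
    field_simp
    ring
  refine ⟨((hprod.integral_prod_right.const_mul (2 * Real.pi)⁻¹).congr hinner), ?_⟩
  rw [← integral_congr_ae hinner, integral_const_mul, ← integral_integral_swap hprod]
  simp_rw [hval]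
  rw [integral_const, hν]
  simp only [measureReal_restrict_apply_univ, Real.volume_real_Ioc, smul_eq_mul, sub_zero]
  rw [max_eq_left (by positivity)]
  field_simp

/-- The averaged kernel is 1-Lipschitz in `s`, so `|K|` dominates, and for fixed `t` it is
differentiable off the null set `‖y‖ = ‖e^t x‖` and the origin. -/
theorem hasDerivAt_log_potential [Nontrivial E] {J : E →ₗᵢ[ℝ] E}
    (hJ : ∀ x, inner ℝ x (J x) = 0) {K : E → ℝ} (hK : Integrable K)
    (hrad : ∀ x y, ‖x‖ = ‖y‖ → K x = K y)
    (hlog : ∀ x, Integrable fun y => Real.log (‖y‖ / ‖x - y‖) * K y) (x : E) (t : ℝ) :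
    HasDerivAt (fun s => ∫ y, Real.log (‖y‖ / ‖Real.exp s • x - y‖) * K y)
      (-∫ y, orbitSlope (‖Real.exp t • x‖ ^ 2) (‖y‖ ^ 2) (hermSq J (Real.exp t • x) y) * K y)
      t := by
  have hexp : ∀ s : ℝ, Real.exp s ^ 2 = Real.exp (2 * s) := fun s => by
    rw [← Real.exp_nat_mul]; norm_num
  have hn : ∀ s, ‖Real.exp s • x‖ ^ 2 = Real.exp (2 * s) * ‖x‖ ^ 2 := fun s => by
    rw [norm_smul, mul_pow, Real.norm_eq_abs, sq_abs, hexp]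
  have hw : ∀ s y, hermSq J (Real.exp s • x) y = Real.exp (2 * s) * hermSq J x y := fun s y => by
    rw [hermSq_smul, hexp]
  have heq := fun s => log_potential_eq_orbitLog hJ hK hrad (hlog (Real.exp s • x))
  simp_rw [fun s => (heq s).2]
  rw [← integral_neg]
  refine (hasDerivAt_integral_of_dominated_loc_of_lip (s := Set.univ) (bound := fun y => |K y|)
    Filter.univ_mem (Filter.Eventually.of_forall fun s => (heq s).1.aestronglyMeasurable)
    (heq t).1 ?_ ?_ hK.abs ?_).2
  · exact ((measurable_orbitSlope_kernel J).comp
      measurable_prodMk_left).aestronglyMeasurable.mul hK.aestronglyMeasurable |>.neg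
  · filter_upwards [ae_ne_zero_and_norm_ne (0 : ℝ)] with y hy
    refine LipschitzOnWith.of_dist_le_mul fun a _ b _ => ?_
    have := abs_orbitLog_exp_sub_le (sq_nonneg ‖x‖) (show 0 < ‖y‖ ^ 2 by
      have := hy.1; positivity) (hermSq_le hJ x y) b a
    simp only [Real.dist_eq, Real.coe_nnabs, abs_abs, hn, hw]
    rw [← sub_mul, abs_mul, mul_comm, abs_sub_comm a b]
    refine mul_le_mul_of_nonneg_left ?_ (abs_nonneg _)
    rwa [sub_sub_sub_cancel_left]
  · filter_upwards [ae_ne_zero_and_norm_ne ‖Real.exp t • x‖] with y hy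
    have hne : Real.exp (2 * t) * ‖x‖ ^ 2 ≠ ‖y‖ ^ 2 := by
      rw [← hn]
      intro h
      exact hy.2 ((sq_eq_sq₀ (norm_nonneg _) (norm_nonneg _)).1 h).symm
    have := hasDerivAt_orbitLog_exp (sq_nonneg ‖x‖) (show 0 < ‖y‖ ^ 2 by
      have := hy.1; positivity) (hermSq_le hJ x y) hne
    simp only [hn, hw]
    exact ((this.const_sub (Real.log ‖y‖)).mul_const (K y)).congr_deriv (by ring)

end Rotation

/-! ### The Pohozaev identity by dilation. -/

theorem scaling_identity {E : Type*} [NormedAddCommGroup E] [InnerProductSpace ℝ E]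
    [FiniteDimensional ℝ E] [MeasurableSpace E] [BorelSpace E] {u M : E → ℝ} {N q B : ℝ}
    (hN : N = Module.finrank ℝ E) (hq : 0 ≤ q) (hu : Continuous u) (hM : Measurable M)
    (hB : ∀ x, |M x| ≤ B)
    (hder : ∀ x t, HasDerivAt (fun s => u (Real.exp s • x)) (-M (Real.exp t • x)) t)
    (hf : Integrable fun x => ‖x‖ ^ q * Real.exp (N * u x)) :
    ∫ x, (N + q - N * M x) * (‖x‖ ^ q * Real.exp (N * u x)) = 0 := by
  have hN0 : 0 ≤ N := by rw [hN]; positivity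
  have hB0 : 0 ≤ B := (abs_nonneg _).trans (hB 0)
  set f : E → ℝ := fun x => ‖x‖ ^ q * Real.exp (N * u x) with hfdef
  -- This is `e^(Ns) f(e^s x)`, with the factor `e^(qs)` moved from the norm into the exponent so
  -- that only `u` has to be differentiated along the ray.
  set F : ℝ → E → ℝ := fun s x =>
    ‖x‖ ^ q * Real.exp ((N + q) * s + N * u (Real.exp s • x)) with hF
  have hFf : ∀ s x, F s x = Real.exp (N * s) * f (Real.exp s • x) := by
    intro s x
    simp only [hF, hfdef, norm_smul, Real.norm_eq_abs, Real.abs_exp]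
    rw [Real.mul_rpow (Real.exp_pos s).le (norm_nonneg x), ← Real.exp_mul, add_mul, Real.exp_add,
      Real.exp_add, mul_comm q s]
    ring
  have hconst : ∀ s, ∫ x, F s x = ∫ x, f x := by
    intro s
    simp_rw [hFf]
    rw [integral_const_mul, Measure.integral_comp_smul_of_nonneg _ _ _ (hR := (Real.exp_pos s).le),
      ← Real.exp_nat_mul, ← hN, smul_eq_mul, ← mul_assoc, mul_inv_cancel₀ (Real.exp_ne_zero _),
      one_mul]
  have hF0 : F 0 = f := by
    funext x; simp [hF, hfdef]
  have hFcont : ∀ s, Measurable (F s) := fun s =>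
    (Continuous.mul (continuous_norm.rpow_const fun _ => Or.inr hq) (by fun_prop)).measurable
  have hmain := hasDerivAt_integral_of_dominated_loc_of_deriv_le (μ := (volume : Measure E))
    (F := F) (F' := fun s x => (N + q - N * M (Real.exp s • x)) * F s x) (x₀ := (0 : ℝ))
    (s := Metric.ball 0 1)
    (bound := fun x => (N + q + N * B) * (Real.exp (N + q + N * B) * f x))
    (Metric.ball_mem_nhds _ one_pos)
    (Filter.Eventually.of_forall fun s => (hFcont s).aestronglyMeasurable)
    (by rw [hF0]; exact hf)
    ?_ ?_ ((hf.const_mul _).const_mul _) ?_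
  · have h0 : HasDerivAt (fun s => ∫ x, F s x) 0 0 := by
      simp_rw [hconst]; exact hasDerivAt_const _ _
    have := hmain.2.unique h0
    simpa only [Real.exp_zero, one_smul, hF0] using this
  · refine Measurable.aestronglyMeasurable ?_
    exact (((hM.comp (measurable_const_smul _)).const_mul N).const_sub _).mul (hFcont 0)
  · refine Filter.Eventually.of_forall fun x s hs => ?_
    have hs1 : |s| ≤ 1 := by
      rw [Metric.mem_ball, dist_zero_right, Real.norm_eq_abs] at hs; exact hs.le
    -- The mean value inequality along the ray bounds the change of `u` uniformly in `x`, so a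
    -- constant multiple of `f` dominates.
    have hlip : |u (Real.exp s • x) - u x| ≤ B := by
      have := Convex.norm_image_sub_le_of_norm_hasDerivWithin_le (s := Set.univ)
        (f := fun s => u (Real.exp s • x)) (C := B) (x := 0) (y := s)
        (fun t _ => (hder x t).hasDerivWithinAt)
        (fun t _ => by rw [norm_neg]; exact hB _) convex_univ trivial trivial
      simp only [Real.exp_zero, one_smul, Real.norm_eq_abs, sub_zero] at this
      exact this.trans (mul_le_of_le_one_right hB0 hs1)
    have hF1 : F s x ≤ Real.exp (N + q + N * B) * f x := by
      have : (N + q) * s + N * u (Real.exp s • x) ≤ (N + q + N * B) + N * u x := by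
        have h1 := mul_le_mul_of_nonneg_left ((abs_le.1 hs1).2) (add_nonneg hN0 hq)
        have h2 := mul_le_mul_of_nonneg_left ((abs_le.1 hlip).2) hN0
        linarith
      have := mul_le_mul_of_nonneg_left (Real.exp_le_exp.2 this)
        (Real.rpow_nonneg (norm_nonneg x) q)
      rw [Real.exp_add _ (N * u x)] at this
      simp only [hF, hfdef]
      linarith
    have hF2 : 0 ≤ F s x := by simp only [hF]; positivity
    have hc : |N + q - N * M (Real.exp s • x)| ≤ N + q + N * B := by
      have := abs_le.1 (hB (Real.exp s • x))
      have h1 := mul_le_mul_of_nonneg_left this.1 hN0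
      have h2 := mul_le_mul_of_nonneg_left this.2 hN0
      rw [abs_le]; constructor <;> linarith
    rw [norm_mul, Real.norm_eq_abs, Real.norm_eq_abs, abs_of_nonneg hF2]
    exact mul_le_mul hc hF1 hF2 ((abs_nonneg _).trans hc)
  · refine Filter.Eventually.of_forall fun x s _ => ?_
    have := ((((hasDerivAt_id s).const_mul (N + q)).add
      ((hder x s).const_mul N)).exp).const_mul (‖x‖ ^ q)
    refine this.congr_deriv ?_
    simp only [hF, Pi.add_apply, id]
    ring

/-! ### Interaction energies of two densities. -/

/-- The bilinear form of the kernel `orbitSlope`. -/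
noncomputable def slopeForm {E : Type*} [NormedAddCommGroup E] [InnerProductSpace ℝ E]
    [MeasureSpace E] (J : E →ₗᵢ[ℝ] E) (f g : E → ℝ) : ℝ :=
  ∫ x, f x * ∫ y, orbitSlope (‖x‖ ^ 2) (‖y‖ ^ 2) (hermSq J x y) * g y

section SlopeForm

variable {E : Type*} [NormedAddCommGroup E] [InnerProductSpace ℝ E] [FiniteDimensional ℝ E]
  [MeasurableSpace E] [BorelSpace E] {J : E →ₗᵢ[ℝ] E}

theorem integrable_slope_mul (hJ : ∀ x, inner ℝ x (J x) = 0) {g : E → ℝ} (hg : Integrable g)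
    (x : E) :
    Integrable fun y => orbitSlope (‖x‖ ^ 2) (‖y‖ ^ 2) (hermSq J x y) * g y := by
  refine hg.bdd_mul (c := 1) ((measurable_orbitSlope_kernel J).comp
    measurable_prodMk_left).aestronglyMeasurable (Filter.Eventually.of_forall fun y => ?_)
  rw [Real.norm_of_nonneg (orbitSlope_nonneg (hermSq_le hJ x y))]
  exact orbitSlope_le_one (hermSq_le hJ x y)

theorem integrable_slope_prod (hJ : ∀ x, inner ℝ x (J x) = 0) {f g : E → ℝ} (hf : Integrable f)
    (hg : Integrable g) :
    Integrable (fun z : E × E => orbitSlope (‖z.1‖ ^ 2) (‖z.2‖ ^ 2) (hermSq J z.1 z.2) *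
      (f z.1 * g z.2)) (volume.prod volume) := by
  refine (hf.mul_prod hg).bdd_mul (c := 1) (measurable_orbitSlope_kernel J).aestronglyMeasurable
    (Filter.Eventually.of_forall fun z => ?_)
  rw [Real.norm_of_nonneg (orbitSlope_nonneg (hermSq_le hJ z.1 z.2))]
  exact orbitSlope_le_one (hermSq_le hJ z.1 z.2)

theorem slopeForm_eq_prod (hJ : ∀ x, inner ℝ x (J x) = 0) {f g : E → ℝ} (hf : Integrable f)
    (hg : Integrable g) :
    slopeForm J f g = ∫ z : E × E, orbitSlope (‖z.1‖ ^ 2) (‖z.2‖ ^ 2) (hermSq J z.1 z.2) *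
      (f z.1 * g z.2) ∂(volume.prod volume) := by
  rw [integral_prod _ (integrable_slope_prod hJ hf hg), slopeForm]
  refine integral_congr_ae (Filter.Eventually.of_forall fun x => ?_)
  simp only
  rw [← integral_const_mul]
  congr 1; funext y; ring

/-- Fubini and `k(x, y) + k(y, x) = 1`. For `f = g` it evaluates the self-interaction as half the
squared mass. -/
theorem slopeForm_add_swap (hJ : ∀ x, inner ℝ x (J x) = 0) {f g : E → ℝ} (hf : Integrable f)
    (hg : Integrable g) :
    slopeForm J f g + slopeForm J g f = (∫ x, f x) * ∫ x, g x := by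
  have h : Integrable (fun z : E × E => orbitSlope (‖z.2‖ ^ 2) (‖z.1‖ ^ 2) (hermSq J z.2 z.1) *
      (g z.2 * f z.1)) (volume.prod volume) := (integrable_slope_prod hJ hg hf).swap
  rw [slopeForm_eq_prod hJ hf hg, slopeForm_eq_prod hJ hg hf, add_comm,
    ← integral_prod_swap]
  simp only [Prod.fst_swap, Prod.snd_swap]
  rw [← integral_add h (integrable_slope_prod hJ hf hg), ← integral_prod_mul]
  refine integral_congr_ae (Filter.Eventually.of_forall fun z => ?_)
  simp only
  have := orbitSlope_add_swap (‖z.1‖ ^ 2) (‖z.2‖ ^ 2) (hermSq J z.1 z.2)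
  rw [hermSq_comm hJ z.2 z.1]
  linear_combination f z.1 * g z.2 * this

/-- The integrand is nonnegative everywhere and positive on the nonempty open set `0 < ‖y‖ < ‖x‖`.
-/
theorem slopeForm_pos [Nontrivial E] (hJ : ∀ x, inner ℝ x (J x) = 0) {f g : E → ℝ}
    (hf : Integrable f) (hg : Integrable g) (hf0 : ∀ x, 0 ≤ f x) (hg0 : ∀ x, 0 ≤ g x)
    (hf1 : ∀ x, x ≠ 0 → 0 < f x) (hg1 : ∀ x, x ≠ 0 → 0 < g x) : 0 < slopeForm J f g := by
  rw [slopeForm_eq_prod hJ hf hg, integral_pos_iff_support_of_nonneg _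
    (integrable_slope_prod hJ hf hg)]
  · refine lt_of_lt_of_le ?_ (measure_mono (s := {z : E × E | 0 < ‖z.2‖ ∧ ‖z.2‖ < ‖z.1‖}) ?_)
    · refine IsOpen.measure_pos _ ?_ ?_
      · exact (isOpen_lt continuous_const continuous_snd.norm).inter
          (isOpen_lt continuous_snd.norm continuous_fst.norm)
      · obtain ⟨v, hv⟩ := exists_ne (0 : E)
        have := norm_pos_iff.2 hv
        refine ⟨((2 : ℝ) • v, v), this, ?_⟩
        rw [norm_smul, Real.norm_ofNat]; linarith
    · rintro ⟨x, y⟩ ⟨h1, h2⟩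
      have hx : x ≠ 0 := norm_pos_iff.1 (h1.trans h2)
      have := hf1 x hx
      have := hg1 y (norm_pos_iff.1 h1)
      have : 0 < orbitSlope (‖x‖ ^ 2) (‖y‖ ^ 2) (hermSq J x y) :=
        orbitSlope_pos_of_lt (by simp only at h1 h2; gcongr)
      exact ne_of_gt (by simp only; positivity)
  · exact fun z => mul_nonneg (orbitSlope_nonneg (hermSq_le hJ _ _)) (mul_nonneg (hf0 _) (hg0 _))

end SlopeForm

/-! ### Existence of the complex structure, and the constants. -/

/-- Identify `ℝ^(2m)` isometrically with `ℂ^m` and take multiplication by `i`. This is where the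
parity of `n` enters. -/
theorem exists_skew_isometry {n : ℕ} (hn : Even n) :
    ∃ J : EuclideanSpace ℝ (Fin n) →ₗᵢ[ℝ] EuclideanSpace ℝ (Fin n), ∀ x, inner ℝ x (J x) = 0 := by
  obtain ⟨m, rfl⟩ := hn
  let F := PiLp 2 (fun _ : Fin m => ℂ)
  have hdim : Module.finrank ℝ (EuclideanSpace ℝ (Fin (m + m))) = Module.finrank ℝ F := by
    rw [finrank_euclideanSpace_fin,
      (WithLp.linearEquiv 2 ℝ (Fin m → ℂ)).finrank_eq, Module.finrank_pi_fintype]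
    simp [Complex.finrank_real_complex]; ring
  let e : EuclideanSpace ℝ (Fin (m + m)) ≃ₗᵢ[ℝ] F :=
    (stdOrthonormalBasis ℝ _).equiv (stdOrthonormalBasis ℝ F) (finCongr hdim)
  let R : F ≃ₗᵢ[ℝ] F := LinearIsometryEquiv.piLpCongrRight 2 fun _ => rotation
    (Circle.exp (Real.pi / 2))
  refine ⟨((e.trans R).trans e.symm).toLinearIsometry, fun x => ?_⟩
  have h : inner ℝ (e x) (R (e x)) = 0 := by
    rw [PiLp.inner_apply]
    refine Finset.sum_eq_zero fun i _ => ?_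
    have hR : (R (e x)).ofLp i = Complex.I * (e x).ofLp i := by
      change ((Circle.exp (Real.pi / 2) : Circle) : ℂ) * _ = _
      rw [Circle.coe_exp]
      push_cast
      rw [Complex.exp_pi_div_two_mul_I]
      rfl
    rw [hR]
    simp [Complex.inner]
    ring
  rw [← h, ← e.inner_map_map]
  simp

theorem sphereVolume_pos (n : ℕ) : 0 < sphereVolume n := by
  unfold sphereVolume
  rw [measureReal_def, ENNReal.toReal_pos_iff]
  exact ⟨pos_iff_ne_zero.2 (Measure.measure_univ_ne_zero.2 (Measure.toSphere_ne_zero _)),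
    measure_lt_top _ _⟩

theorem normConst_pos (n : ℕ) : 0 < normConst n := by
  have := sphereVolume_pos n
  unfold normConst; positivity

/-! ### The algebra of the balance equations, and the conclusion. -/

theorem total_bounds_of_balance {p b₀ b₁ α : ℝ} (hp : 0 < p) (h₀ : 0 < b₀) (h₁ : 0 < b₁)
    (hα : 0 < α) (e₀ : b₀ = b₀ ^ 2 / 2 + α)
    (e₁ : (1 + p) * b₁ = b₁ ^ 2 / 2 + (b₀ * b₁ - α)) :
    max 2 (2 * p) < b₀ + b₁ ∧ b₀ + b₁ < 2 + 2 * p := by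
  -- With `β = b₀ + b₁`, the sum of the two equations is `β (β - 2) = 2 p b₁`, in which `α` cancels.
  have hs : (b₀ + b₁) * (b₀ + b₁ - 2) = 2 * p * b₁ := by linear_combination -2 * e₀ - 2 * e₁
  have hb : 0 < b₀ + b₁ := by linarith
  have h2 : 0 < b₀ + b₁ - 2 := by
    refine pos_of_mul_pos_right ?_ hb.le
    rw [hs]; positivity
  have hb0 : b₀ < 2 := by
    have : 0 < b₀ * (2 - b₀) := by linarith [show b₀ * (2 - b₀) = 2 * α by linear_combination 2 * e₀]
    linarith [pos_of_mul_pos_right this h₀.le]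
  -- Here `(β - 2)(β - 2p) = 2p (2 - b₀)`, and `b₀ < 2` because `α > 0`.
  have hpp : 0 < b₀ + b₁ - 2 * p := by
    refine pos_of_mul_pos_right (a := b₀ + b₁ - 2) ?_ h2.le
    rw [show (b₀ + b₁ - 2) * (b₀ + b₁ - 2 * p) = 2 * p * (2 - b₀) by linear_combination hs]
    have : 0 < 2 - b₀ := by linarith
    positivity
  refine ⟨max_lt (by linarith) (by linarith), ?_⟩
  -- If `β - 2 ≥ 2p`, the sum identity gives `β ≤ b₁`, against `b₀ > 0`.
  by_contra! hge
  have : (b₀ + b₁) * (2 * p) ≤ 2 * p * b₁ := by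
    rw [← hs]
    exact mul_le_mul_of_nonneg_left (by linarith) hb.le
  nlinarith [mul_pos hp h₀]

theorem mainTheorem5 (n : ℕ) (hn : 2 ≤ n) (hn_even : Even n) (p : ℝ) (hp : 0 < p)
    (u : EuclideanSpace ℝ (Fin n) → ℝ)
    (hu : IsNormalSolution n (powerQ n p) u) (hu_radial : IsRadial u) :
    max 2 (2 * p) < normalizedTotalQ n (powerQ n p) u ∧
      normalizedTotalQ n (powerQ n p) u < 2 + 2 * p := by
  obtain ⟨hcont, hint, hlog, C, heq⟩ := hu
  obtain ⟨J, hJ⟩ := exists_skew_isometry hn_even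
  have : Nonempty (Fin n) := ⟨⟨0, by omega⟩⟩
  have hn0 : (0 : ℝ) < n := by exact_mod_cast (by omega : 0 < n)
  have hnp : 0 < (n : ℝ) * p := by positivity
  set c := normConst n with hc
  have hc0 : 0 < c := normConst_pos n
  -- The factor `‖x‖ ^ 0`, equal to `1` also at the origin, puts `f₀` in the form required by
  -- `scaling_identity` with `q = 0`.
  set f₀ : EuclideanSpace ℝ (Fin n) → ℝ := fun x => ‖x‖ ^ (0 : ℝ) * Real.exp (n * u x) with hf₀
  set f₁ : EuclideanSpace ℝ (Fin n) → ℝ := fun x => ‖x‖ ^ ((n : ℝ) * p) * Real.exp (n * u x)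
    with hf₁
  set K : EuclideanSpace ℝ (Fin n) → ℝ := fun x => powerQ n p x * Real.exp (n * u x) with hKdef
  have hK : ∀ x, K x = f₀ x + f₁ x := fun x => by
    simp only [hKdef, hf₀, hf₁, powerQ, Real.rpow_zero]; ring
  have h0n : ∀ x, 0 < f₀ x := fun x => by simp only [hf₀, Real.rpow_zero]; positivity
  have h1n : ∀ x, 0 ≤ f₁ x := fun x => by simp only [hf₁]; positivity
  have h1p : ∀ x, x ≠ 0 → 0 < f₁ x := fun x hx => by
    have := norm_pos_iff.2 hx
    simp only [hf₁]; positivity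
  have hKrad : ∀ x y, ‖x‖ = ‖y‖ → K x = K y := fun x y h => by
    simp only [hKdef, powerQ, h, hu_radial x y h]
  have hf₀i : Integrable f₀ := by
    refine hint.mono' (Continuous.aestronglyMeasurable (by simp only [hf₀, Real.rpow_zero]; fun_prop))
      (Filter.Eventually.of_forall fun x => ?_)
    rw [Real.norm_of_nonneg (h0n x).le]
    linarith [hK x, h1n x]
  have hf₁i : Integrable f₁ := by
    refine (hint.sub hf₀i).congr (Filter.Eventually.of_forall fun x => ?_)
    change K x - f₀ x = f₁ x
    linarith [hK x]
  have hKi : Integrable K := hint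
  set M : EuclideanSpace ℝ (Fin n) → ℝ := fun x =>
    c * ∫ y, orbitSlope (‖x‖ ^ 2) (‖y‖ ^ 2) (hermSq J x y) * K y with hM
  have hder : ∀ x t, HasDerivAt (fun s => u (Real.exp s • x)) (-M (Real.exp t • x)) t := by
    intro x t
    have := ((hasDerivAt_log_potential hJ hKi hKrad hlog x t).const_mul c).add_const C
    refine (this.congr_deriv ?_).congr_of_eventuallyEq (Filter.Eventually.of_forall fun s => heq _)
    simp only [hM]; ring
  have hMmeas : Measurable M := by
    have hKm : Measurable K := by
      simp only [hKdef, powerQ]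
      exact (Continuous.mul (continuous_const.add
        (continuous_norm.rpow_const fun _ => Or.inr hnp.le)) (by fun_prop)).measurable
    have := ((measurable_orbitSlope_kernel J).mul (hKm.comp measurable_snd)).stronglyMeasurable
    exact (this.integral_prod_right' (ν := volume)).measurable.const_mul c
  have hKn : ∀ x, 0 ≤ K x := fun x => by linarith [hK x, h1n x, h0n x]
  have hMB : ∀ x, |M x| ≤ c * ∫ y, K y := by
    intro x
    have h1 : 0 ≤ ∫ y, orbitSlope (‖x‖ ^ 2) (‖y‖ ^ 2) (hermSq J x y) * K y :=
      integral_nonneg fun y => mul_nonneg (orbitSlope_nonneg (hermSq_le hJ x y)) (hKn y)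
    rw [abs_of_nonneg (mul_nonneg hc0.le h1)]
    refine mul_le_mul_of_nonneg_left ?_ hc0.le
    exact integral_mono (integrable_slope_mul hJ hKi x) hKi fun y =>
      mul_le_of_le_one_left (hKn y) (orbitSlope_le_one (hermSq_le hJ x y))
  have hN : (n : ℝ) = Module.finrank ℝ (EuclideanSpace ℝ (Fin n)) := by simp
  have balance : ∀ (q : ℝ) (f : EuclideanSpace ℝ (Fin n) → ℝ), 0 ≤ q →
      f = (fun x => ‖x‖ ^ q * Real.exp (n * u x)) → Integrable f →
      (n + q) * ∫ x, f x = n * (c * (slopeForm J f f₀ + slopeForm J f f₁)) := by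
    intro q f hq hfdef hf
    have h := scaling_identity hN hq hcont hMmeas hMB hder (hfdef ▸ hf)
    have hsplit : ∀ g, Integrable g → Integrable fun x => f x *
        ∫ y, orbitSlope (‖x‖ ^ 2) (‖y‖ ^ 2) (hermSq J x y) * g y := fun g hg => by
      refine (integrable_slope_prod hJ hf hg).integral_prod_left.congr
        (Filter.Eventually.of_forall fun x => ?_)
      simp only
      rw [← integral_const_mul]
      congr 1; funext y; ring
    have he : ∀ x, (n + q - n * M x) * (‖x‖ ^ q * Real.exp (n * u x)) = (n + q) * f x - n * (c *
        (f x * (∫ y, orbitSlope (‖x‖ ^ 2) (‖y‖ ^ 2) (hermSq J x y) * f₀ y) +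
        f x * ∫ y, orbitSlope (‖x‖ ^ 2) (‖y‖ ^ 2) (hermSq J x y) * f₁ y)) := by
      intro x
      simp only [hM, hK, mul_add]
      rw [integral_add (integrable_slope_mul hJ hf₀i x) (integrable_slope_mul hJ hf₁i x), hfdef]
      ring
    simp_rw [he] at h
    have hs : Integrable fun x =>
        f x * (∫ y, orbitSlope (‖x‖ ^ 2) (‖y‖ ^ 2) (hermSq J x y) * f₀ y) +
        f x * ∫ y, orbitSlope (‖x‖ ^ 2) (‖y‖ ^ 2) (hermSq J x y) * f₁ y := (hsplit f₀ hf₀i).add (hsplit f₁ hf₁i)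
    rw [integral_sub (hf.const_mul _) ((hs.const_mul c).const_mul _), integral_const_mul,
      integral_const_mul, integral_const_mul, integral_add (hsplit f₀ hf₀i) (hsplit f₁ hf₁i)] at h
    exact sub_eq_zero.1 h
  have B0 := balance 0 f₀ le_rfl rfl hf₀i
  have B1 := balance (n * p) f₁ hnp.le rfl hf₁i
  have S00 := slopeForm_add_swap hJ hf₀i hf₀i
  have S11 := slopeForm_add_swap hJ hf₁i hf₁i
  have S01 := slopeForm_add_swap hJ hf₀i hf₁i
  have hpos := slopeForm_pos hJ hf₀i hf₁i (fun x => (h0n x).le) h1n (fun x _ => h0n x) h1p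
  -- The squared mass is twice a positive self-interaction.
  have hm0 : 0 < ∫ x, f₀ x := by
    have := slopeForm_pos hJ hf₀i hf₀i (fun x => (h0n x).le) (fun x => (h0n x).le)
      (fun x _ => h0n x) (fun x _ => h0n x)
    exact pos_of_mul_pos_right (S00 ▸ add_pos this this) (integral_nonneg fun x => (h0n x).le)
  have hm1 : 0 < ∫ x, f₁ x :=
    have := slopeForm_pos hJ hf₁i hf₁i h1n h1n h1p h1p
    pos_of_mul_pos_right (S11 ▸ add_pos this this) (integral_nonneg h1n)
  have htot : normalizedTotalQ n (powerQ n p) u = c * (∫ x, f₀ x) + c * ∫ x, f₁ x := by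
    rw [normalizedTotalQ, ← mul_add, ← integral_add hf₀i hf₁i]
    congr 2; funext x; exact hK x
  rw [htot]
  -- The cross term is `α = c² * slopeForm J f₀ f₁`; `S01` turns the opposite cross term into `b₀ b₁
  -- - α`.
  refine total_bounds_of_balance hp (mul_pos hc0 hm0) (mul_pos hc0 hm1)
    (mul_pos (pow_pos hc0 2) hpos) ?_ ?_
  · rw [add_zero] at B0
    have B0' := mul_left_cancel₀ hn0.ne' B0
    linear_combination c * B0' + c ^ 2 / 2 * S00
  · have B1' : (1 + p) * ∫ x, f₁ x = c * (slopeForm J f₁ f₀ + slopeForm J f₁ f₁) :=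
      mul_left_cancel₀ hn0.ne' (by linear_combination B1)
    linear_combination c * B1' + c ^ 2 / 2 * S11 + c ^ 2 * S01
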